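/- Let $K$ be a field of characteristic $0$, let $s, r_1,\dots,r_s\ge 1$ be integers, and let $R=K[x,\,y_{i,j} : 1\le i\le s,\ 1\le j\le r_i]$ be the polynomial ring in the $1+r_1+\cdots+r_s$ indeterminates $x$ and $y_{i,j}$. Let $a_i, b_{i,j}\in K[x]$ be arbitrary polynomials (the $a_i$ need not be distinct), and consider the Shamsuddin derivation $$D=\frac{\partial}{\partial x}+\sum_{i=1}^{s}\sum_{j=1}^{r_i}\bigl(a_i(x)\,y_{i,j}+b_{i,j}(x)\bigr)\frac{\partial}{\partial y_{i,j}}$$ of $R$. Then the following two statements are equivalent: 1. $D$ is simple, that is, the only ideals $I$ of $R$ with $D(I)\subseteq I$ are $0$ and $R$; 2. the isotropy group $\operatorname{Aut}(R)_D=\{\rho\in\operatorname{Aut}_K(R) : \rho D=D\rho\}$ is trivial, that is, equal to $\{\mathrm{id}\}$. -/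

import Mathlib

/-- A derivation `D` of `R` is simple if `R` has no `D`-stable ideals other than `0` and `R`. -/
def Derivation.IsSimple {K R : Type*} [CommSemiring K] [CommRing R] [Algebra K R]
    (D : Derivation K R R) : Prop :=
  ∀ I : Ideal R, (∀ f ∈ I, D f ∈ I) → I = ⊥ ∨ I = ⊤

/-- The isotropy group `Aut(R)_D`: the `K`-algebra automorphisms of `R` that commute with `D`. -/
def Derivation.isotropyGroup {K R : Type*} [CommSemiring K] [CommRing R] [Algebra K R]
    (D : Derivation K R R) : Subgroup (R ≃ₐ[K] R) where
  carrier := {ρ | ∀ f : R, ρ (D f) = D (ρ f)}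
  one_mem' := fun _ => rfl
  mul_mem' := by
    intro ρ τ hρ hτ f
    rw [AlgEquiv.mul_apply, AlgEquiv.mul_apply, hτ f, hρ (τ f)]
  inv_mem' := by
    intro ρ hρ f
    change ρ.symm (D f) = D (ρ.symm f)
    rw [AlgEquiv.symm_apply_eq, hρ, AlgEquiv.apply_symm_apply]

namespace Shamsuddin

/-- The indeterminates: `none` stands for `x`, and `some ⟨i, j⟩` for `y_{i,j}`, where
`i` runs through `s` indices and `j` through `r i` indices. -/
abbrev Vars {s : ℕ} (r : Fin s → ℕ) : Type := Option (Σ i : Fin s, Fin (r i))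

/-- A polynomial in one indeterminate, regarded as an element of
`K[x] ⊆ K[x, y_{1,1}, …, y_{s,r_s}]`. -/
noncomputable def inX {K : Type*} [CommRing K] {s : ℕ} (r : Fin s → ℕ) (p : Polynomial K) :
    MvPolynomial (Vars r) K :=
  Polynomial.aeval (MvPolynomial.X none) p

/-- The derivation `∂_x + ∑ i, ∑ j, (a_i(x) y_{i,j} + b_{i,j}(x)) ∂_{i,j}` of
`K[x, y_{1,1}, …, y_{s,r_s}]`. -/
noncomputable def derivation {K : Type*} [CommRing K] {s : ℕ} {r : Fin s → ℕ}
    (a : Fin s → Polynomial K) (b : (i : Fin s) → Fin (r i) → Polynomial K) :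
    Derivation K (MvPolynomial (Vars r) K) (MvPolynomial (Vars r) K) :=
  MvPolynomial.pderiv none +
    ∑ i : Fin s, ∑ j : Fin (r i),
      (inX r (a i) * MvPolynomial.X (some ⟨i, j⟩) + inX r (b i j)) •
        MvPolynomial.pderiv (some ⟨i, j⟩)

end Shamsuddin

namespace Shamsuddin

open Polynomial

/-! ### First-order linear differential equations over K[x]. -/

section Univariate

variable {K : Type*} [Field K]

/-! Flatten the double index to p = (i, j), so that D y_p = a_p y_p + b_p. Both statements are
equivalent to `Unsolvable`: no equation z' = α z + ∑ c_p b_p, with c ≠ 0 supported where a_p = α,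
has a solution z in K[x].

A solution makes L = ∑ c_p y_p - z an eigenvector, D L = α L. Then (L) is a proper nonzero stable
ideal, and for c_p ≠ 0 the map y_p ↦ y_p + t L commutes with D, so both statements fail.

Conversely, let the equations be unsolvable. In a proper nonzero stable ideal, take f of minimal
y-degree with the fewest top monomials. Eliminating a top coefficient between f and D f shows that f
is an eigenvector over K(x), and its two highest y-degrees then yield a solution
(`Unsolvable.not_eigen`). So D is simple. If ρ commutes with D, simplicity gives ρ(x) = x + e, and
`Unsolvable.exists_eq_linForm` makes ρ(y_q) affine in the y_p. For e ≠ 0, translation by e would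
carry the finite set of the a_p into itself and force some a_q to be constant, which is excluded.
For e = 0, comparing the terms free of y gives ρ(y_q) = y_q. -/

theorem exists_eq_mul_isCoprime {g : K[X]} (f : K[X]) (hg : g ≠ 0) :
    ∃ d g₁ f₁ : K[X], d ≠ 0 ∧ g = d * g₁ ∧ f = d * f₁ ∧ IsCoprime g₁ f₁ := by
  classical
  obtain ⟨g₁, hg₁⟩ := EuclideanDomain.gcd_dvd_left g f
  obtain ⟨f₁, hf₁⟩ := EuclideanDomain.gcd_dvd_right g f
  have hd : EuclideanDomain.gcd g f ≠ 0 := fun h => hg (EuclideanDomain.gcd_eq_zero_iff.1 h).1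
  refine ⟨_, g₁, f₁, hd, hg₁, hf₁, EuclideanDomain.gcdA g f, EuclideanDomain.gcdB g f, ?_⟩
  apply mul_left_cancel₀ hd
  linear_combination -EuclideanDomain.gcd_eq_gcd_ab g f - EuclideanDomain.gcdA g f * hg₁ -
    EuclideanDomain.gcdB g f * hf₁

/-- Since W(g, f) = g² (f/g)', the Wronskian encodes equations for f/g without denominators; this
lets the fraction be reduced. -/
theorem wronskian_mul_mul (d g f : K[X]) :
    wronskian (d * g) (d * f) = d ^ 2 * wronskian g f := by
  simp only [wronskian, derivative_mul]
  ring

variable [CharZero K]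

/-- If `f / g` has a polynomial logarithmic derivative `p`, then `f / g` is constant. -/
theorem exists_eq_C_mul_of_wronskian_eq {g f p : K[X]} (hg : g ≠ 0)
    (h : wronskian g f = p * (g * f)) : ∃ c : K, f = C c * g ∧ (c ≠ 0 → p = 0) := by
  by_cases hf : f = 0
  · exact ⟨0, by simp [hf], fun h => absurd rfl h⟩
  have hp : p = 0 := by
    by_contra hp
    have hw : wronskian g f ≠ 0 := by
      rw [h]; exact mul_ne_zero hp (mul_ne_zero hg hf)
    -- A nonzero Wronskian has degree below deg g + deg f, whereas p g f has at least that degree.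
    have := natDegree_wronskian_lt_add hw
    rw [h, natDegree_mul hp (mul_ne_zero hg hf), natDegree_mul hg hf] at this
    omega
  rw [hp, zero_mul] at h
  obtain ⟨d, g₁, f₁, hd, rfl, rfl, hco⟩ := exists_eq_mul_isCoprime f hg
  rw [wronskian_mul_mul, mul_eq_zero, or_iff_right (pow_ne_zero 2 hd),
    hco.wronskian_eq_zero_iff, derivative_eq_zero, derivative_eq_zero] at h
  obtain ⟨hg₁, hf₁⟩ := h
  rw [natDegree_eq_zero] at hg₁ hf₁
  obtain ⟨u, rfl⟩ := hg₁
  obtain ⟨v, rfl⟩ := hf₁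
  have hu : u ≠ 0 := by
    rintro rfl
    simp at hg
  refine ⟨v / u, ?_, fun _ => hp⟩
  rw [mul_left_comm, ← C_mul, div_mul_cancel₀ _ hu]

/-- If `h / g` solves `z' = a z + b`, then it is a polynomial. -/
theorem dvd_of_wronskian_eq {g h a b : K[X]} (hg : g ≠ 0)
    (H : wronskian g h = a * (g * h) + g ^ 2 * b) : g ∣ h := by
  obtain ⟨d, g₁, h₁, hd, rfl, rfl, hco⟩ := exists_eq_mul_isCoprime h hg
  have H₁ : wronskian g₁ h₁ = a * (g₁ * h₁) + g₁ ^ 2 * b := by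
    apply mul_left_cancel₀ (pow_ne_zero 2 hd)
    rw [← wronskian_mul_mul, H]
    ring
  -- The reduced denominator divides g₁' h₁, hence g₁' by coprimality; in characteristic 0 it is
  -- then constant.
  have hdvd : g₁ ∣ derivative g₁ * h₁ :=
    ⟨derivative h₁ - a * h₁ - g₁ * b, by rw [wronskian] at H₁; linear_combination -H₁⟩
  have hder := dvd_derivative_iff.1 (hco.dvd_of_dvd_mul_right hdvd)
  rw [derivative_eq_zero, natDegree_eq_zero] at hder
  obtain ⟨u, rfl⟩ := hder
  have hu : u ≠ 0 := by
    rintro rfl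
    simp at hg
  exact mul_dvd_mul_left d ((isUnit_C.2 hu.isUnit).dvd)

/-- A polynomial solution of `z' = a z` with `a ≠ 0` vanishes. -/
theorem eq_zero_of_derivative_eq_mul {a z : K[X]} (ha : a ≠ 0) (h : derivative z = a * z) :
    z = 0 := by
  obtain ⟨c, hz, hc⟩ := exists_eq_C_mul_of_wronskian_eq (g := 1) (f := z) (p := a) one_ne_zero
    (by simp [wronskian, h])
  by_cases h0 : c = 0
  · simp [hz, h0]
  · exact absurd (hc h0) ha

theorem exists_derivative_eq (b : K[X]) : ∃ z : K[X], derivative z = b := by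
  induction b using Polynomial.induction_on' with
  | add p q hp hq =>
    obtain ⟨u, rfl⟩ := hp
    obtain ⟨v, rfl⟩ := hq
    exact ⟨u + v, derivative_add⟩
  | monomial n c =>
    refine ⟨monomial (n + 1) (c / (n + 1)), ?_⟩
    rw [derivative_monomial]
    congr 1
    push_cast
    exact div_mul_cancel₀ _ (Nat.cast_add_one_ne_zero n)

/-- Linear differential equations with constant coefficients have polynomial solutions. -/
theorem exists_derivative_eq_C_mul_add (k : K) (b : K[X]) :
    ∃ z : K[X], derivative z = C k * z + b := by
  by_cases hk : k = 0
  · simpa [hk] using exists_derivative_eq b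
  induction hn : b.natDegree using Nat.strong_induction_on generalizing b with
  | _ n ih =>
    by_cases hb : derivative b = 0
    · refine ⟨-(C k⁻¹ * b), ?_⟩
      rw [derivative_neg, derivative_C_mul, hb, mul_neg, ← mul_assoc, ← C_mul,
        mul_inv_cancel₀ hk]
      simp
    -- Substituting z = w - b/k replaces b by b'/k, of smaller degree.
    · have hlt : (C k⁻¹ * derivative b).natDegree < n := by
        rw [natDegree_C_mul (inv_ne_zero hk), ← hn]
        exact natDegree_derivative_lt fun h => hb (derivative_eq_zero.2 h)
      obtain ⟨w, hw⟩ := ih _ hlt _ rfl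
      refine ⟨w - C k⁻¹ * b, ?_⟩
      have : (C k * C k⁻¹ : K[X]) = 1 := by rw [← C_mul, mul_inv_cancel₀ hk, C_1]
      rw [derivative_sub, hw, derivative_C_mul]
      linear_combination b * this

/-- A polynomial of period e ≠ 0 takes the value a(0) at the infinitely many points n e. -/
theorem exists_eq_C_of_taylor_eq_self {e : K} (he : e ≠ 0) {a : K[X]} (h : taylor e a = a) :
    ∃ k : K, a = C k := by
  refine ⟨a.eval 0, eq_of_infinite_eval_eq _ _ ?_⟩
  have hn : ∀ n : ℕ, a.eval (n * e) = a.eval 0 := by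
    intro n
    induction n with
    | zero => simp
    | succ n ih => rw [← ih, Nat.cast_succ, add_one_mul, ← taylor_eval, h]
  refine (Set.infinite_range_of_injective (f := fun n : ℕ => (n : K) * e) ?_).mono ?_
  · intro m n hmn
    exact Nat.cast_injective (mul_right_cancel₀ he hmn)
  · rintro _ ⟨n, rfl⟩
    simp [hn]

end Univariate

/-! ### The solvability condition and its extraction from an eigenvector. -/

section Solvability

theorem exists_eq_add_single {ι : Type*} {m : ι →₀ ℕ} (h : m.degree ≠ 0) :
    ∃ n q, m = n + Finsupp.single q 1 := by
  obtain ⟨q, hq⟩ : ∃ q, m q ≠ 0 := by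
    by_contra! h'
    exact h (by rw [show m = 0 from Finsupp.ext h']; simp)
  exact ⟨m - Finsupp.single q 1, q,
    (tsub_add_cancel_of_le (Finsupp.single_le_iff.2 (Nat.one_le_iff_ne_zero.2 hq))).symm⟩

variable {K : Type*} [Field K] {σ : Type*} [Fintype σ]

/-- No equation `z' = α z + ∑ c_p b_p` with constants `c_p`, not all zero and supported on the
indices with `a_p = α`, has a polynomial solution. -/
def Unsolvable (a b : σ → K[X]) : Prop :=
  ∀ (α : K[X]) (c : σ → K) (z : K[X]), (∀ p, c p ≠ 0 → a p = α) →
    derivative z = α * z + ∑ p, C (c p) * b p → c = 0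

/-- A constant coefficient a_p would make z' = a_p z + b_p solvable. -/
theorem Unsolvable.ne_C [CharZero K] {a b : σ → K[X]} (h : Unsolvable a b) (p : σ) (k : K) :
    a p ≠ C k := by
  classical
  intro hp
  obtain ⟨z, hz⟩ := exists_derivative_eq_C_mul_add k (b p)
  have := h (a p) (Pi.single p 1) z
    (fun q hq => by
      by_contra hne
      exact hq (Pi.single_eq_of_ne (fun e => hne (by rw [e])) _))
    (by simp [hz, hp, Pi.single_apply, apply_ite C, ite_mul])
  simpa using congrFun this p

/-- The weight `∑ m_p a_p` by which a monomial `y ^ m` is scaled. -/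
noncomputable def weight (a : σ → K[X]) (m : σ →₀ ℕ) : K[X] := ∑ p, (m p : K[X]) * a p

theorem weight_add_single (a : σ → K[X]) (m : σ →₀ ℕ) (q : σ) :
    weight a (m + Finsupp.single q 1) = weight a m + a q := by
  classical
  simp [weight, add_mul, Finset.sum_add_distrib, Finsupp.single_apply]

/-- The action of the derivation on families of coefficients. -/
noncomputable def coeffDeriv (a b : σ → K[X]) (F : (σ →₀ ℕ) → K[X]) (m : σ →₀ ℕ) : K[X] :=
  derivative (F m) + weight a m * F m +
    ∑ p, ((m p : K[X]) + 1) * b p * F (m + Finsupp.single p 1)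

theorem coeffDeriv_of_top {a b : σ → K[X]} {F : (σ →₀ ℕ) → K[X]} {m : σ →₀ ℕ}
    (h : ∀ p, F (m + Finsupp.single p 1) = 0) :
    coeffDeriv a b F m = derivative (F m) + weight a m * F m := by
  simp [coeffDeriv, h]

/-- A family of coefficients of positive top degree that is, in degrees at least the top degree
minus one, an eigenvector up to the rational factor `F m₀` produces a solvable equation. -/
theorem Unsolvable.not_eigen [CharZero K] {a b : σ → K[X]} (hab : Unsolvable a b)
    {F : (σ →₀ ℕ) → K[X]} {m₀ : σ →₀ ℕ} (h₀ : m₀.degree ≠ 0) (hF₀ : F m₀ ≠ 0)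
    (htop : ∀ m, m₀.degree < m.degree → F m = 0)
    (heig : ∀ m, m₀.degree ≤ m.degree + 1 →
      F m₀ * coeffDeriv a b F m = (derivative (F m₀) + weight a m₀ * F m₀) * F m) : False := by
  classical
  -- In top degree, F m / F m₀ has the polynomial logarithmic derivative `weight a m₀ - weight a m`,
  -- so it is constant, and the weights agree when it is nonzero.
  have hconst : ∀ m, m.degree = m₀.degree →
      ∃ c : K, F m = C c * F m₀ ∧ (c ≠ 0 → weight a m₀ - weight a m = 0) := by
    intro m hm
    apply exists_eq_C_mul_of_wronskian_eq hF₀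
    have := heig m (by omega)
    rw [coeffDeriv_of_top fun p => htop _ (by simp [hm])] at this
    rw [wronskian]
    linear_combination this
  obtain ⟨m, q, rfl⟩ := exists_eq_add_single h₀
  have hdeg : ∀ p, (m + Finsupp.single p 1).degree = m.degree + 1 := fun p => by simp
  have hconst' : ∀ p, ∃ c : K, F (m + Finsupp.single p 1) = C c * F (m + Finsupp.single q 1) ∧
      (c ≠ 0 → weight a (m + Finsupp.single q 1) - weight a (m + Finsupp.single p 1) = 0) :=
    fun p => hconst _ (by rw [hdeg, hdeg])
  choose c hc hc' using hconst'
  generalize hg : F (m + Finsupp.single q 1) = g at *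
  have hsum : coeffDeriv a b F m = derivative (F m) + weight a m * F m +
      (∑ p, C (((m p : K) + 1) * c p) * b p) * g := by
    rw [coeffDeriv, Finset.sum_mul]
    congr 1
    refine Finset.sum_congr rfl fun p _ => ?_
    rw [hc p]
    simp only [C_mul, C_add, C_1, map_natCast]
    ring
  have hm := heig m (by rw [hdeg])
  rw [hsum, weight_add_single] at hm
  -- One degree below the top, F m / g is a rational solution of an equation of the forbidden kind,
  -- hence a polynomial.
  have hdvd : g ∣ F m := dvd_of_wronskian_eq (a := a q)
    (b := -∑ p, C (((m p : K) + 1) * c p) * b p) hF₀ (by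
      rw [wronskian]; linear_combination hm)
  obtain ⟨z, hz⟩ := hdvd
  have hsol : derivative z = a q * z + ∑ p, C (-(((m p : K) + 1) * c p)) * b p := by
    apply mul_left_cancel₀ (pow_ne_zero 2 hF₀)
    simp only [C_neg, neg_mul, Finset.sum_neg_distrib]
    rw [hz, derivative_mul] at hm
    linear_combination hm
  have hcq : c q = 1 := by
    have := hc q
    rw [hg] at this
    apply C_injective
    exact mul_right_cancel₀ hF₀ (by rw [← this, C_1, one_mul])
  -- Equality of the weights of m + p and m + q says a_p = a_q. The coefficient at q is -(m_q + 1),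
  -- nonzero in characteristic 0.
  have hzero := congrFun (hab (a q) _ z (fun p hp => by
    have := hc' p (by rintro h; simp [h] at hp)
    rw [weight_add_single, weight_add_single] at this
    linear_combination -this) hsol) q
  rw [hcq] at hzero
  simp only [mul_one, Pi.zero_apply, neg_eq_zero] at hzero
  exact Nat.cast_add_one_ne_zero _ hzero

end Solvability
end Shamsuddin
namespace Shamsuddin

open MvPolynomial

/-! ### Coefficients in K[x] of the y-monomials, and the derivation read on them. -/

section Multivariate

variable {K : Type*} [Field K] {σ : Type*}

/-- The coefficient of `y ^ m` in a polynomial in `x` and the `y_p`. -/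
noncomputable def yCoeff (f : MvPolynomial (Option σ) K) (m : σ →₀ ℕ) : Polynomial K :=
  coeff m (optionEquivRight K σ f)

/-- A polynomial in `x`, regarded as a polynomial in `x` and the `y_p`. -/
noncomputable def ofX (σ : Type*) (p : Polynomial K) : MvPolynomial (Option σ) K :=
  Polynomial.aeval (X none) p

theorem ofX_add (p q : Polynomial K) : ofX σ (p + q) = ofX σ p + ofX σ q := map_add _ _ _

theorem ofX_mul (p q : Polynomial K) : ofX σ (p * q) = ofX σ p * ofX σ q := map_mul _ _ _

theorem ofX_sub (p q : Polynomial K) : ofX σ (p - q) = ofX σ p - ofX σ q := map_sub _ _ _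

theorem ofX_C (k : K) : ofX σ (Polynomial.C k) = C k := Polynomial.aeval_C _ _

theorem ofX_sum {ι : Type*} (s : Finset ι) (p : ι → Polynomial K) :
    ofX σ (∑ i ∈ s, p i) = ∑ i ∈ s, ofX σ (p i) := map_sum _ _ _

@[simp]
theorem optionEquivRight_ofX (p : Polynomial K) : optionEquivRight K σ (ofX σ p) = C p := by
  rw [ofX, ← Polynomial.aeval_algHom_apply, optionEquivRight_X_none]
  induction p using Polynomial.induction_on' with
  | add p q hp hq => rw [map_add, hp, hq, C_add]
  | monomial n c =>
    rw [Polynomial.aeval_monomial, ← C_pow, ← Polynomial.C_mul_X_pow_eq_monomial, C_mul]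
    rfl

theorem yCoeff_injective {f g : MvPolynomial (Option σ) K} (h : ∀ m, yCoeff f m = yCoeff g m) :
    f = g :=
  (optionEquivRight K σ).injective (MvPolynomial.ext _ _ h)

@[simp]
theorem yCoeff_add (f g : MvPolynomial (Option σ) K) (m : σ →₀ ℕ) :
    yCoeff (f + g) m = yCoeff f m + yCoeff g m := by simp [yCoeff]

@[simp]
theorem yCoeff_sub (f g : MvPolynomial (Option σ) K) (m : σ →₀ ℕ) :
    yCoeff (f - g) m = yCoeff f m - yCoeff g m := by simp [yCoeff]

@[simp]
theorem yCoeff_zero (m : σ →₀ ℕ) : yCoeff (0 : MvPolynomial (Option σ) K) m = 0 := by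
  simp [yCoeff]

@[simp]
theorem yCoeff_ofX_mul (p : Polynomial K) (f : MvPolynomial (Option σ) K) (m : σ →₀ ℕ) :
    yCoeff (ofX σ p * f) m = p * yCoeff f m := by
  rw [yCoeff, map_mul, optionEquivRight_ofX, coeff_C_mul, yCoeff]

theorem yCoeff_sum {ι : Type*} (s : Finset ι) (f : ι → MvPolynomial (Option σ) K) (m : σ →₀ ℕ) :
    yCoeff (∑ i ∈ s, f i) m = ∑ i ∈ s, yCoeff (f i) m := by simp [yCoeff, coeff_sum]

theorem yCoeff_ofX [DecidableEq σ] (p : Polynomial K) (m : σ →₀ ℕ) :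
    yCoeff (ofX σ p) m = if 0 = m then p else 0 := by
  rw [yCoeff, optionEquivRight_ofX, coeff_C]

theorem yCoeff_ofX_of_ne {m : σ →₀ ℕ} (hm : m ≠ 0) (p : Polynomial K) :
    yCoeff (ofX σ p) m = 0 := by
  classical
  rw [yCoeff_ofX, if_neg hm.symm]

theorem yCoeff_X [DecidableEq σ] (q : σ) (m : σ →₀ ℕ) :
    yCoeff (X (some q) : MvPolynomial (Option σ) K) m =
      if Finsupp.single q 1 = m then 1 else 0 := by
  rw [yCoeff, optionEquivRight_X_some, coeff_X]

theorem eq_ofX_of_yCoeff {f : MvPolynomial (Option σ) K} (h : ∀ m, m ≠ 0 → yCoeff f m = 0) :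
    f = ofX σ (yCoeff f 0) := by
  classical
  apply yCoeff_injective
  intro m
  rw [yCoeff_ofX]
  split_ifs with hm
  · rw [hm]
  · exact h m (Ne.symm hm)

theorem optionEquivRight_rename (f : MvPolynomial σ K) :
    optionEquivRight K σ (rename some f) = MvPolynomial.map Polynomial.C f := by
  induction f using MvPolynomial.induction_on with
  | C k => rw [rename_C, optionEquivRight_C, map_C]
  | add f g hf hg => rw [map_add, map_add, hf, hg, map_add]
  | mul_X f i hf => rw [map_mul, map_mul, hf, map_mul, rename_X, optionEquivRight_X_some, map_X]

/-- The elements of `K[x, y]` are `∑ y ^ m g_m(x)`. -/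
theorem induction_on_yMonomial {P : MvPolynomial (Option σ) K → Prop}
    (hadd : ∀ f g, P f → P g → P (f + g))
    (hmon : ∀ p m, P (ofX σ p * rename some (monomial m 1))) (f : MvPolynomial (Option σ) K) :
    P f := by
  have key : ∀ F : MvPolynomial σ (Polynomial K), P ((optionEquivRight K σ).symm F) := by
    intro F
    induction F using MvPolynomial.induction_on' with
    | monomial m p =>
      convert hmon p m
      rw [AlgEquiv.symm_apply_eq, map_mul, optionEquivRight_ofX]
      rw [optionEquivRight_rename, map_monomial, C_mul_monomial, map_one, mul_one]
    | add f g hf hg => rw [map_add]; exact hadd _ _ hf hg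
  rw [← (optionEquivRight K σ).symm_apply_apply f]
  exact key _

theorem yCoeff_monomial [DecidableEq σ] (m n : σ →₀ ℕ) :
    yCoeff (rename some (monomial m 1) : MvPolynomial (Option σ) K) n =
      if m = n then 1 else 0 := by
  rw [yCoeff, optionEquivRight_rename, map_monomial, map_one, coeff_monomial]

theorem finite_setOf_yCoeff_ne_zero (f : MvPolynomial (Option σ) K) :
    {m | yCoeff f m ≠ 0}.Finite :=
  (optionEquivRight K σ f).support.finite_toSet.subset fun _ hm => mem_support_iff.2 hm

theorem pderiv_none_ofX (p : Polynomial K) :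
    pderiv none (ofX σ p) = ofX σ (Polynomial.derivative p) := by
  rw [ofX, Derivation.map_aeval, pderiv_X_self, smul_eq_mul, mul_one, ofX]

theorem pderiv_some_ofX (q : σ) (p : Polynomial K) : pderiv (some q) (ofX σ p) = 0 := by
  rw [ofX, Derivation.map_aeval, pderiv_X_of_ne (by simp), smul_zero]

theorem pderiv_none_rename (G : MvPolynomial σ K) :
    pderiv none (rename some G : MvPolynomial (Option σ) K) = 0 := by
  induction G using MvPolynomial.induction_on with
  | C k => rw [rename_C, pderiv_C]
  | add f g hf hg => rw [map_add, map_add, hf, hg, add_zero]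
  | mul_X f i hf =>
    rw [map_mul, Derivation.leibniz, hf, rename_X, pderiv_X_of_ne (by simp)]
    simp

theorem yCoeff_pderiv_none (f : MvPolynomial (Option σ) K) (m : σ →₀ ℕ) :
    yCoeff (pderiv none f) m = Polynomial.derivative (yCoeff f m) := by
  classical
  induction f using induction_on_yMonomial with
  | hadd f g hf hg => simp only [map_add, yCoeff_add, hf, hg]
  | hmon p n =>
    rw [Derivation.leibniz, pderiv_none_rename, pderiv_none_ofX, smul_zero, zero_add, smul_eq_mul,
      mul_comm, yCoeff_ofX_mul, yCoeff_ofX_mul, yCoeff_monomial]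
    split_ifs <;> simp

theorem yCoeff_pderiv_some (q : σ) (f : MvPolynomial (Option σ) K) (m : σ →₀ ℕ) :
    yCoeff (pderiv (some q) f) m =
      ((m q : Polynomial K) + 1) * yCoeff f (m + Finsupp.single q 1) := by
  have : optionEquivRight K σ (pderiv (some q) f) = pderiv q (optionEquivRight K σ f) := by
    induction f using MvPolynomial.induction_on with
    | C k => rw [pderiv_C, optionEquivRight_C, pderiv_C, map_zero]
    | add f g hf hg => simp only [map_add, hf, hg]
    | mul_X f i hf =>
      rw [Derivation.leibniz, map_add, map_mul, Derivation.leibniz, smul_eq_mul, smul_eq_mul,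
        map_mul, map_mul, hf, smul_eq_mul, smul_eq_mul]
      congr 2
      classical
      cases i with
      | none => rw [pderiv_X_of_ne (by simp), optionEquivRight_X_none, pderiv_C, map_zero]
      | some i =>
        rw [optionEquivRight_X_some, pderiv_X, pderiv_X]
        by_cases h : i = q
        · subst h; simp
        · rw [Pi.single_eq_of_ne h, Pi.single_eq_of_ne (by simpa using h), map_zero]
  rw [yCoeff, this, coeff_pderiv, mul_comm, yCoeff]

theorem yCoeff_X_mul_pderiv (q : σ) (f : MvPolynomial (Option σ) K) (m : σ →₀ ℕ) :
    yCoeff (X (some q) * pderiv (some q) f) m = (m q : Polynomial K) * yCoeff f m := by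
  classical
  rw [mul_comm, yCoeff, map_mul, optionEquivRight_X_some, coeff_mul_X']
  split_ifs with h
  · have hq : 1 ≤ m q := Nat.one_le_iff_ne_zero.2 (Finsupp.mem_support_iff.1 h)
    have := yCoeff_pderiv_some q f (m - Finsupp.single q 1)
    rw [tsub_add_cancel_of_le (Finsupp.single_le_iff.2 hq)] at this
    rw [yCoeff] at this
    rw [this, Finsupp.tsub_apply, Finsupp.single_eq_same, Nat.cast_sub hq]
    simp
  · rw [Finsupp.notMem_support_iff.1 h]
    simp

variable [Fintype σ]

/-- The derivation `∂_x + ∑ p, (a_p(x) y_p + b_p(x)) ∂_p`. -/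
noncomputable def shamsuddin (a b : σ → Polynomial K) :
    Derivation K (MvPolynomial (Option σ) K) (MvPolynomial (Option σ) K) :=
  pderiv none + ∑ p, (ofX σ (a p) * X (some p) + ofX σ (b p)) • pderiv (some p)

theorem shamsuddin_apply (a b : σ → Polynomial K) (f : MvPolynomial (Option σ) K) :
    shamsuddin a b f =
      pderiv none f + ∑ p, (ofX σ (a p) * X (some p) + ofX σ (b p)) * pderiv (some p) f := by
  
  rw [shamsuddin, Derivation.add_apply]
  congr 1
  generalize Finset.univ (α := σ) = s
  classical
  induction s using Finset.induction_on with
  | empty => simp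
  | insert p s hp ih =>
    rw [Finset.sum_insert hp, Finset.sum_insert hp, Derivation.add_apply, ih,
      Derivation.smul_apply, smul_eq_mul]

theorem shamsuddin_X_none (a b : σ → Polynomial K) : shamsuddin a b (X none) = 1 := by
  rw [shamsuddin_apply, pderiv_X_self]
  simp [pderiv_X_of_ne]

theorem shamsuddin_ofX (a b : σ → Polynomial K) (p : Polynomial K) :
    shamsuddin a b (ofX σ p) = ofX σ (Polynomial.derivative p) := by
  rw [shamsuddin_apply, pderiv_none_ofX]
  simp [pderiv_some_ofX]

theorem shamsuddin_X_some (a b : σ → Polynomial K) (q : σ) :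
    shamsuddin a b (X (some q)) = ofX σ (a q) * X (some q) + ofX σ (b q) := by
  classical
  rw [shamsuddin_apply, pderiv_X_of_ne (by simp), zero_add, Finset.sum_eq_single q]
  · rw [pderiv_X_self, mul_one]
  · intro p _ hp
    rw [pderiv_X_of_ne (by simpa using hp.symm), mul_zero]
  · simp

theorem yCoeff_shamsuddin (a b : σ → Polynomial K) (f : MvPolynomial (Option σ) K)
    (m : σ →₀ ℕ) : yCoeff (shamsuddin a b f) m = coeffDeriv a b (yCoeff f) m := by
  rw [shamsuddin_apply, yCoeff_add, yCoeff_pderiv_none, yCoeff_sum, coeffDeriv, add_assoc, weight,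
    Finset.sum_mul, ← Finset.sum_add_distrib]
  congr 1
  refine Finset.sum_congr rfl fun p _ => ?_
  rw [add_mul, yCoeff_add, mul_assoc, yCoeff_ofX_mul, yCoeff_ofX_mul, yCoeff_X_mul_pderiv,
    yCoeff_pderiv_some]
  ring

end Multivariate
end Shamsuddin
namespace Shamsuddin

open MvPolynomial

/-! ### Each of the two statements implies unsolvability. -/

section Criterion

variable {K : Type*} [Field K] {σ : Type*}

/-- An eigenvector of a simple derivation is zero or a unit. -/
theorem eq_zero_or_isUnit_of_isSimple {R : Type*} [CommRing R] [Algebra K R]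
    {D : Derivation K R R} (hD : D.IsSimple) {f g : R} (h : D f = g * f) :
    f = 0 ∨ IsUnit f := by
  refine (hD (Ideal.span {f}) ?_).imp Ideal.span_singleton_eq_bot.1 Ideal.span_singleton_eq_top.1
  intro u hu
  obtain ⟨v, rfl⟩ := Ideal.mem_span_singleton.1 hu
  refine Ideal.mem_span_singleton.2 ⟨D v + v * g, ?_⟩
  rw [Derivation.leibniz, h, smul_eq_mul, smul_eq_mul]
  ring

theorem exists_eq_C_of_isUnit {f : MvPolynomial (Option σ) K} (h : IsUnit f) : ∃ k, f = C k := by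
  obtain ⟨k, -, hk⟩ := isUnit_iff_eq_C_of_isReduced.1 h
  exact ⟨k, hk⟩

theorem algHom_comm_of_X {R : Type*} [CommRing R] [Algebra K R] {ι : Type*}
    (D : Derivation K (MvPolynomial ι K) (MvPolynomial ι K)) (D' : Derivation K R R)
    (ρ : MvPolynomial ι K →ₐ[K] R) (h : ∀ v, ρ (D (X v)) = D' (ρ (X v))) (f : MvPolynomial ι K) :
    ρ (D f) = D' (ρ f) := by
  induction f using MvPolynomial.induction_on with
  | C k =>
    rw [← algebraMap_eq, AlgHom.commutes, Derivation.map_algebraMap, Derivation.map_algebraMap,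
      map_zero]
  | add f g hf hg => simp only [map_add, hf, hg]
  | mul_X f i hf => simp only [map_mul, Derivation.leibniz, map_add, smul_eq_mul, hf, h]

/-- The `K`-algebra endomorphism `y_p ↦ y_p + t f`. -/
noncomputable def shear (p : σ) (f : MvPolynomial (Option σ) K) (t : K) :
    MvPolynomial (Option σ) K →ₐ[K] MvPolynomial (Option σ) K := by
  classical exact aeval fun v => X v + if v = some p then C t * f else 0

theorem shear_X_some_self (p : σ) (f : MvPolynomial (Option σ) K) (t : K) :
    shear p f t (X (some p)) = X (some p) + C t * f := by
  simp [shear]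

theorem shear_X_of_ne {p : σ} {v : Option σ} (hv : v ≠ some p) (f : MvPolynomial (Option σ) K)
    (t : K) : shear p f t (X v) = X v := by
  simp [shear, hv]

theorem shear_ofX (p : σ) (f : MvPolynomial (Option σ) K) (t : K) (q : Polynomial K) :
    shear p f t (ofX σ q) = ofX σ q := by
  rw [ofX, ← Polynomial.aeval_algHom_apply, shear_X_of_ne (by simp)]

theorem shear_C (p : σ) (f : MvPolynomial (Option σ) K) (t k : K) :
    shear p f t (C k) = C k := AlgHom.commutes _ k

variable [Fintype σ] {a b : σ → Polynomial K}

/-- The polynomial `∑ p, c_p y_p - z(x)`. -/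
noncomputable def linForm (c : σ → K) (z : Polynomial K) : MvPolynomial (Option σ) K :=
  ∑ p, C (c p) * X (some p) - ofX σ z

theorem yCoeff_linForm_single (c : σ → K) (z : Polynomial K) (q : σ) :
    yCoeff (linForm c z) (Finsupp.single q 1) = Polynomial.C (c q) := by
  classical
  rw [linForm, yCoeff_sub, yCoeff_sum, yCoeff_ofX_of_ne (by simp), sub_zero,
    Finset.sum_eq_single q]
  · rw [← ofX_C, yCoeff_ofX_mul, yCoeff_X, if_pos rfl, mul_one]
  · intro p _ hp
    rw [← ofX_C, yCoeff_ofX_mul, yCoeff_X, if_neg, mul_zero]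
    simpa [Finsupp.single_left_inj] using hp
  · simp

theorem yCoeff_linForm_zero (c : σ → K) (z : Polynomial K) :
    yCoeff (linForm c z) 0 = -z := by
  classical
  rw [linForm, yCoeff_sub, yCoeff_sum, yCoeff_ofX, if_pos rfl, Finset.sum_eq_zero, zero_sub]
  intro p _
  rw [← ofX_C, yCoeff_ofX_mul, yCoeff_X, if_neg (by simp), mul_zero]

theorem yCoeff_linForm_of_two_le (c : σ → K) (z : Polynomial K) {m : σ →₀ ℕ}
    (hm : 2 ≤ m.degree) : yCoeff (linForm c z) m = 0 := by
  classical
  rw [linForm, yCoeff_sub, yCoeff_sum, yCoeff_ofX_of_ne, sub_zero, Finset.sum_eq_zero]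
  · intro p _
    rw [← ofX_C, yCoeff_ofX_mul, yCoeff_X, if_neg, mul_zero]
    rintro rfl
    simp at hm
  · rintro rfl
    simp at hm

theorem linForm_zero_left (z : Polynomial K) : linForm (0 : σ → K) z = ofX σ (-z) := by
  rw [linForm, ← zero_sub, ofX_sub]
  simp [ofX]

theorem linForm_ne_zero {c : σ → K} {p : σ} (hc : c p ≠ 0) (z : Polynomial K) :
    linForm c z ≠ 0 := by
  intro h
  have := yCoeff_linForm_single c z p
  rw [h, yCoeff_zero, eq_comm, Polynomial.C_eq_zero] at this
  exact hc this

theorem shamsuddin_linForm {α z : Polynomial K} {c : σ → K} (hc : ∀ p, c p ≠ 0 → a p = α)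
    (hz : Polynomial.derivative z = α * z + ∑ p, Polynomial.C (c p) * b p) :
    shamsuddin a b (linForm c z) = ofX σ α * linForm c z := by
  rw [linForm, map_sub, map_sum, shamsuddin_ofX, hz, mul_sub, Finset.mul_sum, ofX_add, ofX_mul,
    ofX_sum, ← sub_sub, sub_right_comm, ← Finset.sum_sub_distrib]
  congr 1
  refine Finset.sum_congr rfl fun p _ => ?_
  rw [ofX_mul, ofX_C, ← smul_eq_C_mul, Derivation.map_smul, shamsuddin_X_some]
  by_cases h : c p = 0
  · simp [h]
  · rw [hc p h, smul_eq_C_mul, smul_eq_C_mul]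
    ring

theorem unsolvable_of_isSimple (h : (shamsuddin a b).IsSimple) : Unsolvable a b := by
  intro α c z hc hz
  by_contra hne
  obtain ⟨p, hp⟩ := Function.ne_iff.1 hne
  rcases eq_zero_or_isUnit_of_isSimple h (shamsuddin_linForm hc hz) with h0 | hu
  · exact linForm_ne_zero hp z h0
  · obtain ⟨k, hk⟩ := exists_eq_C_of_isUnit hu
    have := yCoeff_linForm_single c z p
    rw [hk, ← ofX_C, yCoeff_ofX_of_ne (by simp), eq_comm, Polynomial.C_eq_zero] at this
    exact hp this

theorem shear_linForm (p : σ) (c : σ → K) (z : Polynomial K) (t : K) :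
    shear p (linForm c z) t (linForm c z) = C (1 + c p * t) * linForm c z := by
  classical
  have h : ∀ f, shear p f t (linForm c z) = linForm c z + C (c p * t) * f := by
    intro f
    rw [linForm, map_sub, shear_ofX, map_sum, sub_add_eq_add_sub]
    congr 1
    rw [← Finset.add_sum_erase _ _ (Finset.mem_univ p),
      ← Finset.add_sum_erase (a := p) _ (fun q => C (c q) * X (some q)) (Finset.mem_univ p),
      map_mul, shear_C, shear_X_some_self, Finset.sum_congr rfl fun q hq => by
        rw [map_mul, shear_C, shear_X_of_ne (by simpa using Finset.ne_of_mem_erase hq)], C_mul]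
    ring
  rw [h, C_add, C_1]
  ring

/-- The inner shear adds u L, which the outer one rescales by 1 + c_p t: the total multiple of L
added to y_p is t + u (1 + c_p t). -/
theorem shear_comp_shear (p : σ) (c : σ → K) (z : Polynomial K) {t u : K}
    (h : t + u * (1 + c p * t) = 0) :
    (shear p (linForm c z) t).comp (shear p (linForm c z) u) = AlgHom.id K _ := by
  refine MvPolynomial.algHom_ext fun v => ?_
  rw [AlgHom.comp_apply, AlgHom.id_apply]
  by_cases hv : v = some p
  · subst hv
    rw [shear_X_some_self, map_add, shear_X_some_self, map_mul, shear_C, shear_linForm, add_assoc,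
      ← mul_assoc, ← add_mul, ← C_mul, ← C_add, h, C_0, zero_mul, add_zero]
  · rw [shear_X_of_ne hv, shear_X_of_ne hv]

theorem shear_comm {α z : Polynomial K} {c : σ → K} (hc : ∀ p, c p ≠ 0 → a p = α)
    (hz : Polynomial.derivative z = α * z + ∑ p, Polynomial.C (c p) * b p) {p : σ}
    (hp : c p ≠ 0) (t : K) (f : MvPolynomial (Option σ) K) :
    shear p (linForm c z) t (shamsuddin a b f) = shamsuddin a b (shear p (linForm c z) t f) := by
  refine algHom_comm_of_X _ _ _ (fun v => ?_) f
  cases v with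
  | none => rw [shear_X_of_ne (by simp), shamsuddin_X_none, map_one]
  | some q =>
    rw [shamsuddin_X_some, map_add, map_mul, shear_ofX, shear_ofX]
    by_cases hq : q = p
    · subst hq
      rw [shear_X_some_self, map_add, shamsuddin_X_some, ← smul_eq_C_mul, Derivation.map_smul,
        shamsuddin_linForm hc hz, hc q hp, smul_eq_C_mul, smul_eq_C_mul]
      ring
    · rw [shear_X_of_ne (by simpa using hq), shamsuddin_X_some]

theorem unsolvable_of_isotropyGroup_eq_bot [CharZero K]
    (h : (shamsuddin a b).isotropyGroup = ⊥) : Unsolvable a b := by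
  intro α c z hc hz
  by_contra hne
  obtain ⟨p, hp⟩ := Function.ne_iff.1 hne
  rw [Pi.zero_apply] at hp
  let ρ : MvPolynomial (Option σ) K ≃ₐ[K] MvPolynomial (Option σ) K :=
    -- The choice t = 1/c_p scales L by 2, a unit in characteristic 0; the inverse parameter is
    -- -t/2.
    AlgEquiv.ofAlgHom (shear p (linForm c z) (c p)⁻¹) (shear p (linForm c z) (-(2 * c p)⁻¹))
      (shear_comp_shear p c z (by field_simp; norm_num))
      (shear_comp_shear p c z (by field_simp; norm_num))
  have hρ : ρ ∈ (shamsuddin a b).isotropyGroup := fun f => shear_comm hc hz hp _ f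
  rw [h, Subgroup.mem_bot] at hρ
  have hX : shear p (linForm c z) (c p)⁻¹ (X (some p)) = X (some p) :=
    congrArg (fun τ : MvPolynomial (Option σ) K ≃ₐ[K] MvPolynomial (Option σ) K =>
      τ (X (some p))) hρ
  rw [shear_X_some_self, add_eq_left, mul_eq_zero, C_eq_zero, inv_eq_zero] at hX
  exact hX.elim hp (linForm_ne_zero hp z)

end Criterion
end Shamsuddin
namespace Shamsuddin

open MvPolynomial

/-! ### Unsolvability implies both statements. -/

section Equivalence

variable {K : Type*} [Field K] [CharZero K] {σ : Type*} [Fintype σ] {a b : σ → Polynomial K}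

/-- A stable ideal containing a nonzero polynomial in `x` is the unit ideal. -/
theorem eq_top_of_ofX_mem {I : Ideal (MvPolynomial (Option σ) K)}
    (hI : ∀ f ∈ I, shamsuddin a b f ∈ I) {p : Polynomial K} (hp : p ≠ 0) (hmem : ofX σ p ∈ I) :
    I = ⊤ := by
  induction hn : p.natDegree using Nat.strong_induction_on generalizing p with
  | _ n ih =>
    by_cases h : Polynomial.derivative p = 0
    · rw [Polynomial.derivative_eq_zero, Polynomial.natDegree_eq_zero] at h
      obtain ⟨k, rfl⟩ := h
      refine Ideal.eq_top_of_isUnit_mem _ hmem ?_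
      rw [ofX_C]
      exact (isUnit_iff_ne_zero.2 fun hk => hp (by rw [hk, Polynomial.C_0])).map C
    · refine ih _ ?_ h ?_ rfl
      · rw [← hn]
        exact Polynomial.natDegree_derivative_lt fun h' => h (Polynomial.derivative_eq_zero.2 h')
      · rw [← shamsuddin_ofX a b]
        exact hI _ hmem

theorem isSimple_of_unsolvable (hab : Unsolvable a b) : (shamsuddin a b).IsSimple := by
  classical
  intro I hI
  by_contra! hne
  obtain ⟨hbot, htop⟩ := hne
  have hex : ∃ n, ∃ f ∈ I, f ≠ 0 ∧ ∀ m, n < m.degree → yCoeff f m = 0 := by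
    obtain ⟨f, hf, hf0⟩ := (Submodule.ne_bot_iff I).1 hbot
    obtain ⟨n, hn⟩ := ((finite_setOf_yCoeff_ne_zero f).image Finsupp.degree).bddAbove
    refine ⟨n, f, hf, hf0, fun m hm => ?_⟩
    by_contra h
    exact absurd (hn ⟨m, h, rfl⟩) (not_le.2 hm)
  set n := Nat.find hex with hn
  have hmin : ∀ j < n, ¬ _ := fun j hj => Nat.find_min hex hj
  -- Second minimisation: the number of monomials of y-degree n.
  have hex' : ∃ k, ∃ f ∈ I, f ≠ 0 ∧ (∀ m, n < m.degree → yCoeff f m = 0) ∧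
      {m | m.degree = n ∧ yCoeff f m ≠ 0}.ncard = k := by
    obtain ⟨f, hf, hf0, h⟩ := Nat.find_spec hex
    exact ⟨_, f, hf, hf0, h, rfl⟩
  obtain ⟨f, hf, hf0, hdeg, hcard⟩ := Nat.find_spec hex'
  have hmin' : ∀ j < Nat.find hex', ¬ _ := fun j hj => Nat.find_min hex' hj
  rcases Nat.eq_zero_or_pos n with hn0 | hpos
  · have hfx : f = ofX σ (yCoeff f 0) := eq_ofX_of_yCoeff fun m hm => hdeg m (by
      rw [hn0, Nat.pos_iff_ne_zero]
      exact fun h => hm ((Finsupp.degree_eq_zero_iff m).1 h))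
    refine htop (eq_top_of_ofX_mem hI (p := yCoeff f 0) (fun h => hf0 ?_) (hfx ▸ hf))
    rw [hfx, h, ofX, map_zero]
  obtain ⟨m₀, hm₀, hF₀⟩ : ∃ m₀, m₀.degree = n ∧ yCoeff f m₀ ≠ 0 := by
    by_contra! h
    refine hmin (n - 1) (by omega) ⟨f, hf, hf0, fun m hm => ?_⟩
    rcases (show n ≤ m.degree by omega).eq_or_lt with h' | h'
    · exact h m h'.symm
    · exact hdeg m h'
  -- This combination lies in I, loses the monomial m₀ and gains none in degree ≥ n, so minimality
  -- forces it to vanish.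
  set h := ofX σ (yCoeff f m₀) * shamsuddin a b f -
    ofX σ (Polynomial.derivative (yCoeff f m₀) + weight a m₀ * yCoeff f m₀) * f with hh
  have hcoeff : ∀ m, yCoeff h m = yCoeff f m₀ * coeffDeriv a b (yCoeff f) m -
      (Polynomial.derivative (yCoeff f m₀) + weight a m₀ * yCoeff f m₀) * yCoeff f m := by
    intro m
    rw [hh, yCoeff_sub, yCoeff_ofX_mul, yCoeff_ofX_mul, yCoeff_shamsuddin]
  have hcoeff' : ∀ m, n ≤ m.degree → yCoeff h m = yCoeff f m₀ *
      (Polynomial.derivative (yCoeff f m) + weight a m * yCoeff f m) -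
      (Polynomial.derivative (yCoeff f m₀) + weight a m₀ * yCoeff f m₀) * yCoeff f m := by
    intro m hm
    rw [hcoeff, coeffDeriv_of_top fun p => hdeg _ (by simpa using Nat.lt_succ_of_le hm)]
  have hhI : h ∈ I := I.sub_mem (I.mul_mem_left _ (hI f hf)) (I.mul_mem_left _ hf)
  have hzero : h = 0 := by
    by_contra hne
    refine hmin' {m | m.degree = n ∧ yCoeff h m ≠ 0}.ncard ?_ ⟨h, hhI, hne, fun m hm => ?_, rfl⟩
    · rw [← hcard]
      refine Set.ncard_lt_ncard ⟨fun m ⟨hm, hm'⟩ => ⟨hm, fun h0 => hm' ?_⟩, fun hsub => ?_⟩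
        ((finite_setOf_yCoeff_ne_zero f).subset fun m hm => hm.2)
      · rw [hcoeff' m hm.ge, h0]
        simp
      · refine (hsub ⟨hm₀, hF₀⟩).2 ?_
        rw [hcoeff' _ hm₀.ge]
        ring
    · rw [hcoeff' m hm.le, hdeg m hm]
      simp
  refine hab.not_eigen (F := yCoeff f) (m₀ := m₀) (by omega) hF₀ (by rwa [hm₀]) fun m _ => ?_
  rw [← sub_eq_zero, ← hcoeff, hzero, yCoeff_zero]

/-- In the unsolvable case, the solutions of `D G = α G + β` are affine in the `y_p`, with
constant linear coefficients. -/
theorem Unsolvable.exists_eq_linForm (hab : Unsolvable a b) {α β : Polynomial K}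
    {G : MvPolynomial (Option σ) K} (hG : shamsuddin a b G = ofX σ α * G + ofX σ β) :
    ∃ c z, G = linForm c z ∧ ∀ p, c p ≠ 0 → a p = α := by
  classical
  have hcoeff : ∀ m, m ≠ 0 → coeffDeriv a b (yCoeff G) m = α * yCoeff G m := by
    intro m hm
    rw [← yCoeff_shamsuddin, hG, yCoeff_add, yCoeff_ofX_mul, yCoeff_ofX_of_ne hm, add_zero]
  have hdeg : ∀ m : σ →₀ ℕ, 2 ≤ m.degree → yCoeff G m = 0 := by
    by_contra! h
    have hfin := (finite_setOf_yCoeff_ne_zero G).subset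
      (show {m : σ →₀ ℕ | 2 ≤ m.degree ∧ yCoeff G m ≠ 0} ⊆ _ from fun m hm => hm.2)
    obtain ⟨m₀, ⟨hm₀, hF₀⟩, hmax⟩ := hfin.exists_maximalFor Finsupp.degree _ h
    have htop : ∀ m, m₀.degree < m.degree → yCoeff G m = 0 := by
      intro m hm
      by_contra hne
      exact absurd (hmax ⟨by omega, hne⟩ hm.le) (not_le.2 hm)
    refine hab.not_eigen (by omega) hF₀ htop fun m hm => ?_
    have h₀ := hcoeff m₀ (by rintro rfl; simp at hm₀)
    rw [coeffDeriv_of_top fun p => htop _ (by simp)] at h₀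
    rw [hcoeff m (by rintro rfl; simp at hm; omega), h₀]
    ring
  have hlin : ∀ p, ∃ c : K, yCoeff G (Finsupp.single p 1) = Polynomial.C c ∧
      (c ≠ 0 → a p = α) := by
    intro p
    have h := hcoeff (Finsupp.single p 1) (by simp)
    have hw : weight a (Finsupp.single p 1) = a p := by
      rw [← zero_add (Finsupp.single p 1), weight_add_single]
      simp [weight]
    rw [coeffDeriv_of_top fun q => hdeg _ (by simp), hw] at h
    obtain ⟨c, hc, hc'⟩ := exists_eq_C_mul_of_wronskian_eq (g := 1) (p := α - a p)
      (f := yCoeff G (Finsupp.single p 1)) one_ne_zero (by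
        rw [Polynomial.wronskian, Polynomial.derivative_one]
        linear_combination h)
    exact ⟨c, by rw [hc, mul_one], fun h => (sub_eq_zero.1 (hc' h)).symm⟩
  choose c hc hcα using hlin
  refine ⟨c, -yCoeff G 0, yCoeff_injective fun m => ?_, hcα⟩
  rcases le_or_gt 2 m.degree with h2 | h2
  · rw [hdeg m h2, yCoeff_linForm_of_two_le _ _ h2]
  · by_cases h0 : m.degree = 0
    · rw [(Finsupp.degree_eq_zero_iff m).1 h0, yCoeff_linForm_zero, neg_neg]
    · obtain ⟨p, rfl⟩ : ∃ p, m = Finsupp.single p 1 := by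
        obtain ⟨n, p, rfl⟩ := exists_eq_add_single h0
        have hn : n.degree = 0 := by
          simp only [map_add, Finsupp.degree_single] at h2
          omega
        exact ⟨p, by rw [(Finsupp.degree_eq_zero_iff n).1 hn, zero_add]⟩
      rw [hc, yCoeff_linForm_single]

theorem isotropyGroup_eq_bot_of_unsolvable [Nonempty σ] (hab : Unsolvable a b) :
    (shamsuddin a b).isotropyGroup = ⊥ := by
  classical
  refine (Subgroup.eq_bot_iff_forall _).2 fun ρ hρ => ?_
  replace hρ : ∀ f, ρ (shamsuddin a b f) = shamsuddin a b (ρ f) := hρ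
  obtain ⟨e, he⟩ : ∃ e : K, ρ (X none) = X none + C e := by
    have h : shamsuddin a b (ρ (X none) - X none) = 0 * (ρ (X none) - X none) := by
      rw [map_sub, ← hρ, shamsuddin_X_none, map_one, sub_self, zero_mul]
    rcases eq_zero_or_isUnit_of_isSimple (isSimple_of_unsolvable hab) h with h0 | hu
    · exact ⟨0, by rw [C_0, add_zero, sub_eq_zero.1 h0]⟩
    · obtain ⟨k, hk⟩ := exists_eq_C_of_isUnit hu
      exact ⟨k, by rw [← hk]; ring⟩
  have hofX : ∀ p, ρ (ofX σ p) = ofX σ (Polynomial.taylor e p) := by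
    intro p
    rw [ofX, ← Polynomial.aeval_algHom_apply, he, Polynomial.taylor_apply, ofX,
      Polynomial.aeval_comp]
    simp
  have hlin : ∀ q, ∃ c z, ρ (X (some q)) = linForm c z ∧
      ∀ p, c p ≠ 0 → a p = Polynomial.taylor e (a q) := fun q =>
    hab.exists_eq_linForm (β := Polynomial.taylor e (b q)) (by
      rw [← hρ, shamsuddin_X_some, map_add, map_mul, hofX, hofX])
  have hshift : ∀ q, ∃ p, a p = Polynomial.taylor e (a q) := by
    intro q
    obtain ⟨c, z, hcz, hc⟩ := hlin q
    by_contra! hne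
    have hc0 : c = 0 := funext fun p => by_contra fun h => hne p (hc p h)
    -- If c = 0, then ρ(y_q) lies in K[x] = ρ(K[x]), against injectivity.
    have : X (some q) = ofX σ (Polynomial.taylor (-e) (-z)) := by
      apply ρ.injective
      rw [hofX, Polynomial.taylor_taylor, add_neg_cancel, Polynomial.taylor_zero, hcz, hc0,
        linForm_zero_left]
    have h1 := congrArg (yCoeff · (Finsupp.single q 1)) this
    simp only [yCoeff_X, if_true] at h1
    rw [yCoeff_ofX_of_ne (by simp)] at h1
    exact one_ne_zero h1
  have he0 : e = 0 := by
    by_contra he0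
    choose next hnext using hshift
    obtain ⟨q⟩ := ‹Nonempty σ›
    have hiter : ∀ n : ℕ, a (next^[n] q) = Polynomial.taylor (n * e) (a q) := by
      intro n
      induction n with
      | zero => simp
      | succ n ih =>
        rw [Function.iterate_succ_apply', hnext, ih, Polynomial.taylor_taylor]
        congr 1
        push_cast
        ring_nf
    -- The orbit of q in the finite index set repeats, so a_q has the nonzero period (l - k) e.
    obtain ⟨k, l, hkl, hq⟩ := Finite.exists_ne_map_eq_of_infinite fun n : ℕ => next^[n] q
    have heq : Polynomial.taylor (k * e) (a q) = Polynomial.taylor (l * e) (a q) := by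
      rw [← hiter, ← hiter]
      exact congrArg a hq
    obtain ⟨u, hu⟩ := exists_eq_C_of_taylor_eq_self (e := -(k * e) + l * e) (a := a q) (by
        rw [← neg_mul, ← add_mul, ← sub_eq_neg_add]
        exact mul_ne_zero (sub_ne_zero.2 fun h => hkl (Nat.cast_injective h).symm) he0) (by
        rw [← Polynomial.taylor_taylor, ← heq, Polynomial.taylor_taylor, neg_add_cancel,
          Polynomial.taylor_zero])
    exact hab.ne_C q u hu
  subst he0
  rw [C_0, add_zero] at he
  have hX : ∀ q, ρ (X (some q)) = X (some q) := by
    intro q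
    obtain ⟨c, z, hcz, hc⟩ := hlin q
    rw [Polynomial.taylor_zero] at hc
    -- The terms free of y give z' = a_q z + ∑ c_p b_p - b_q, the equation attached to c - δ_q;
    -- hence c = δ_q.
    have h0 := congrArg (yCoeff · 0) (hρ (X (some q)))
    simp only [shamsuddin_X_some, map_add, map_mul, hofX, Polynomial.taylor_zero, hcz,
      yCoeff_shamsuddin, yCoeff_add, yCoeff_ofX_mul, yCoeff_linForm_zero, yCoeff_ofX, if_true,
      coeffDeriv, zero_add, yCoeff_linForm_single, Finsupp.coe_zero, Pi.zero_apply, weight,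
      Nat.cast_zero, zero_mul, Finset.sum_const_zero, one_mul, Polynomial.derivative_neg] at h0
    have hsum : ∑ p, Polynomial.C ((c - Pi.single q 1 : σ → K) p) * b p =
        ∑ p, b p * Polynomial.C (c p) - b q := by
      simp only [Pi.sub_apply, Polynomial.C_sub, sub_mul, Finset.sum_sub_distrib]
      congr 1
      · exact Finset.sum_congr rfl fun p _ => mul_comm _ _
      · simp [Pi.single_apply, apply_ite Polynomial.C, ite_mul]
    have hcq := hab (a q) (c - Pi.single q 1) z (fun p hp => by
        by_cases hpq : p = q
        · rw [hpq]
        · exact hc p (by simpa [Pi.single_eq_of_ne hpq] using hp)) (by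
        rw [hsum]
        linear_combination h0)
    rw [hcq] at hsum
    have hz : z = 0 := eq_zero_of_derivative_eq_mul (a := a q)
      (by simpa using hab.ne_C q 0) (by
        simp only [Pi.zero_apply, Polynomial.C_0, zero_mul, Finset.sum_const_zero] at hsum
        linear_combination h0 - hsum)
    rw [hcz, hz, sub_eq_zero.1 hcq, linForm, Finset.sum_eq_single q]
    · simp [ofX]
    · intro p _ hp
      rw [Pi.single_eq_of_ne hp, C_0, zero_mul]
    · simp
  have : (ρ : MvPolynomial (Option σ) K →ₐ[K] _) = AlgHom.id K _ :=
    MvPolynomial.algHom_ext fun v => by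
      cases v with
      | none => exact he
      | some q => exact hX q
  exact AlgEquiv.ext fun f => DFunLike.congr_fun this f

/-- Some y_p must be present: d/dx on K[x] is simple but commutes with all translations. -/
theorem shamsuddin_isSimple_iff [Nonempty σ] :
    (shamsuddin a b).IsSimple ↔ (shamsuddin a b).isotropyGroup = ⊥ :=
  ⟨fun h => isotropyGroup_eq_bot_of_unsolvable (unsolvable_of_isSimple h),
    fun h => isSimple_of_unsolvable (unsolvable_of_isotropyGroup_eq_bot h)⟩

end Equivalence

theorem derivation_eq_shamsuddin {K : Type*} [Field K] {s : ℕ} {r : Fin s → ℕ}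
    (a : Fin s → Polynomial K) (b : (i : Fin s) → Fin (r i) → Polynomial K) :
    derivation a b =
      shamsuddin (fun p : Σ i : Fin s, Fin (r i) => a p.1) (fun p => b p.1 p.2) := by
  rw [derivation, shamsuddin, Fintype.sum_sigma]
  rfl

end Shamsuddin

theorem theorem2p8 {K : Type*} [Field K] [CharZero K] {s : ℕ} (hs : 1 ≤ s)
    (r : Fin s → ℕ) (hr : ∀ i, 1 ≤ r i)
    (a : Fin s → Polynomial K) (b : (i : Fin s) → Fin (r i) → Polynomial K) :
    (Shamsuddin.derivation a b).IsSimple ↔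
      (Shamsuddin.derivation a b).isotropyGroup = ⊥ := by
  have : Nonempty (Σ i : Fin s, Fin (r i)) := ⟨⟨⟨0, hs⟩, ⟨0, hr _⟩⟩⟩
  rw [Shamsuddin.derivation_eq_shamsuddin]
  exact Shamsuddin.shamsuddin_isSimple_iff
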